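/- For positive integers $k_1,\dots,k_r$ with $k_r\ge 2$ let $$T(k_1,\dots,k_r)=2^r\sum_{\substack{0<m_1<\cdots<m_r\\ m_j\equiv j \bmod 2}}\frac{1}{m_1^{k_1}\cdots m_r^{k_r}}$$ be the multiple $T$-value, let $\{1\}^{a}$ denote $a$ consecutive entries equal to $1$, and let $B_j(t)$ be the Bernoulli polynomials, $\frac{Xe^{tX}}{e^X-1}=\sum_{j\ge 0}B_j(t)\frac{X^j}{j!}$. Then for all integers $n\ge 1$ and $k\ge 1$, $$T(\{1\}^{2n-1},2k)=\frac{\pi^{2k-1}}{(2k-1)!}\sum_{m=0}^{n-1}\frac{(-1)^{k+m-1}(\pi/2)^{2m}}{(2m+1)!\,(2n-2m-1)!}\int_0^{\pi/2}B_{2k-1}\!\left(\frac{\theta}{\pi}\right)\left(\log\tan\frac{\theta}{2}\right)^{2n-2m-1}d\theta$$ and $$T(\{1\}^{2n-1},2k+1)=\frac{\pi^{2k}}{(2k)!}\sum_{m=0}^{n-1}\frac{(-1)^{k+m-1}(\pi/2)^{2m-1}}{(2m)!\,(2n-2m)!}\int_0^{\pi/2}B_{2k}\!\left(\frac{\theta}{\pi}\right)\left(\log\tan\frac{\theta}{2}\right)^{2n-2m}d\theta,$$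 where the series defining the $T$-values converge and all the integrals converge absolutely. -/

import Mathlib

noncomputable section

namespace MultipleTValue

/-- The summation range of a multiple `T`-value of depth `n`: tuples `0 < m₁ < ⋯ < mₙ` of integers
with `mⱼ ≡ j (mod 2)`. With indices shifted to `j : Fin n`, the congruence reads
`m j ≡ j + 1 (mod 2)`. -/
def indexSet (n : ℕ) : Set (Fin n → ℕ) :=
  {m | StrictMono m ∧ ∀ j : Fin n, 0 < m j ∧ m j ≡ (j : ℕ) + 1 [MOD 2]}

/-- The summand `1 / (m₁ ^ k₁ ⋯ mₙ ^ kₙ)`. -/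
def summand {n : ℕ} (k : Fin n → ℕ) (m : indexSet n) : ℝ :=
  1 / ∏ j : Fin n, ((m : Fin n → ℕ) j : ℝ) ^ k j

/-- The multiple `T`-value `T(k₁, …, kₙ) = 2ⁿ ∑ 1 / (m₁ ^ k₁ ⋯ mₙ ^ kₙ)`. -/
def T {n : ℕ} (k : Fin n → ℕ) : ℝ :=
  2 ^ n * ∑' m : indexSet n, summand k m

/-- The index `({1}^a, b)` of depth `a + 1`: `a` ones followed by `b`. -/
def onesThen (a b : ℕ) : Fin (a + 1) → ℕ :=
  Fin.snoc (α := fun _ => ℕ) (fun _ : Fin a => 1) b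

end MultipleTValue

end

/-! Let `L(z) = log ((1 + z) / (1 - z))`. Since `L' = 2 / (1 - z²)`, the coefficients of `L ^ r /
r!` obey the same recursion as nested sums with alternating parities, and `T({1}^r, p + 1) = ∑ c_m /
m ^ p`, where `c_m` is the coefficient of `z ^ m` in `L ^ (r + 1) / (r + 1)!`
(`hasSum_summand_onesThen`).

For `r + 1 = 2n` only even `m > 0` occur. For these, `1 / m ^ p` is, up to a constant, the integral
over `0 ≤ θ ≤ π / 2` of `B_p(θ / π)` against `cos mθ` (`p` even) or `sin mθ` (`p` odd), by the
Fourier expansion of `B_p` (`integral_bernoulliFun_mul_exp_half`). Hence the `T`-value is an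
integral of `B_p(θ / π)` against the real or imaginary part of `L(e^{iθ}) ^ (2n) / (2n)!`. As
`L(e^{iθ}) = -log tan (θ / 2) + iπ / 2`, the binomial theorem gives both formulas.

The series and the integral are interchanged at radius `x < 1`. Letting `x → 1` uses an integrable
bound uniform in `x`, and nonnegativity of the `c_m` yields convergence of the series
(`hasSum_coef_mul_of_integral_eq`). -/

noncomputable section

namespace MultipleTValue

open Finset Nat

/-! ### Coefficients of powers of `log ((1 + X) / (1 - X))` -/

/-- The power series `∑ 2 X ^ m / m` over odd `m`, that is `log ((1 + X) / (1 - X))`. -/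
def logSeries : PowerSeries ℝ := PowerSeries.mk fun m => if Odd m then 2 / (m : ℝ) else 0

/-- The coefficients of `log ((1 + X) / (1 - X)) ^ r / r!`. -/
def coef (r m : ℕ) : ℝ := PowerSeries.coeff m (logSeries ^ r) / (r ! : ℝ)

lemma coef_zero_left (m : ℕ) : coef 0 m = if m = 0 then 1 else 0 := by
  simp [coef, PowerSeries.coeff_one]

lemma coef_succ_zero (r : ℕ) : coef (r + 1) 0 = 0 := by
  simp [coef, logSeries]

lemma coeff_derivative_logSeries (m : ℕ) :
    PowerSeries.coeff m (PowerSeries.derivative ℝ logSeries) = if Even m then 2 else 0 := by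
  have h : (m : ℝ) + 1 ≠ 0 := by positivity
  rw [PowerSeries.coeff_derivative, logSeries, PowerSeries.coeff_mk]
  by_cases hm : Even m
  · simp [hm, h]
  · simp [hm, Nat.odd_add_one]

/-- Compares coefficients in `(L ^ (r + 1))' = (r + 1) L ^ r L'`. -/
lemma succ_mul_coef_succ (r m : ℕ) :
    ((m : ℝ) + 1) * coef (r + 1) (m + 1) =
      ∑ p ∈ antidiagonal m, coef r p.1 * (if Even p.2 then 2 else 0) := by
  have h := PowerSeries.coeff_derivative (R := ℝ) (logSeries ^ (r + 1)) m
  rw [Derivation.leibniz_pow, map_nsmul, smul_eq_mul, PowerSeries.coeff_mul, nsmul_eq_mul] at h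
  simp only [add_tsub_cancel_right, coeff_derivative_logSeries] at h
  have hr : ((r : ℝ) + 1) ≠ 0 := by positivity
  have hf : (r ! : ℝ) ≠ 0 := by positivity
  simp only [coef, Nat.factorial_succ, div_mul_eq_mul_div, ← Finset.sum_div]
  push_cast at h ⊢
  field_simp
  linarith

lemma coef_eq_zero_of_not_modEq (r m : ℕ) (h : ¬ m ≡ r [MOD 2]) : coef r m = 0 := by
  induction r generalizing m with
  | zero =>
    rw [coef_zero_left, if_neg]
    rintro rfl
    exact h rfl
  | succ r ih =>
    cases m with
    | zero => exact coef_succ_zero r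
    | succ m =>
      have h1 := succ_mul_coef_succ r m
      rw [Finset.sum_eq_zero] at h1
      · exact (mul_eq_zero.1 h1).resolve_left (by positivity)
      · rintro ⟨i, j⟩ hij
        rw [HasAntidiagonal.mem_antidiagonal] at hij
        by_cases hj : Even j
        · rw [ih i, zero_mul]
          intro hi
          apply h
          simp only [Nat.ModEq, Nat.even_iff] at *
          omega
        · simp [hj]

/-- Terms of the wrong parity vanish, so convolution with `2 / (1 - X²)` becomes a plain partial
sum: the recursion of a nested sum in its last index. -/
lemma coef_succ (r m : ℕ) (h : m ≡ r + 1 [MOD 2]) :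
    coef (r + 1) m = 2 / m * ∑ i ∈ range m, coef r i := by
  cases m with
  | zero => simp [coef_succ_zero]
  | succ m =>
    have h1 := succ_mul_coef_succ r m
    rw [Finset.Nat.sum_antidiagonal_eq_sum_range_succ_mk,
      Finset.sum_congr rfl (g := fun i => 2 * coef r i), ← Finset.mul_sum] at h1
    · push_cast
      field_simp
      linarith
    · intro i hi
      rw [mem_range] at hi
      by_cases hir : i ≡ r [MOD 2]
      · rw [if_pos, mul_comm]
        simp only [Nat.ModEq, Nat.even_iff] at *
        omega
      · simp [coef_eq_zero_of_not_modEq r i hir]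

lemma coef_nonneg (r m : ℕ) : 0 ≤ coef r m := by
  refine div_nonneg ?_ (by positivity)
  induction r generalizing m with
  | zero => rw [pow_zero, PowerSeries.coeff_one]; split_ifs <;> simp
  | succ r ih =>
    rw [pow_succ, PowerSeries.coeff_mul]
    refine Finset.sum_nonneg fun p _ => mul_nonneg (ih _) ?_
    rw [logSeries, PowerSeries.coeff_mk]
    split_ifs <;> positivity

/-! ### The `T`-value as a single series over its last index -/

lemma snoc_mem_indexSet {r : ℕ} (m : Fin r → ℕ) (i : ℕ) :
    (Fin.snoc (α := fun _ => ℕ) m i : Fin (r + 1) → ℕ) ∈ indexSet (r + 1) ↔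
      m ∈ indexSet r ∧ (∀ j, m j < i) ∧ 0 < i ∧ i ≡ r + 1 [MOD 2] := by
  constructor
  · rintro ⟨hs, hp⟩
    refine ⟨⟨fun a b hab => ?_, fun j => ?_⟩, fun j => ?_, ?_⟩
    · simpa using hs (Fin.castSucc_lt_castSucc_iff.2 hab)
    · simpa using hp j.castSucc
    · simpa using hs (Fin.castSucc_lt_last j)
    · simpa using hp (Fin.last r)
  · rintro ⟨⟨hs, hp⟩, hlt, hi⟩
    refine ⟨fun a b hab => ?_, fun j => ?_⟩
    · induction b using Fin.lastCases with
      | last =>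
        induction a using Fin.lastCases with
        | last => exact absurd hab (lt_irrefl _)
        | cast a => simpa using hlt a
      | cast b =>
        induction a using Fin.lastCases with
        | last => exact absurd hab (not_lt.2 (Fin.le_last _))
        | cast a => simpa using hs (Fin.castSucc_lt_castSucc_iff.1 hab)
    · induction j using Fin.lastCases with
      | last => simpa using hi
      | cast j => simpa using hp j

/-- The tuples of `indexSet r` with entries less than `M`. -/
def indexFinset : (r M : ℕ) → Finset (Fin r → ℕ)
  | 0, _ => {Fin.elim0}
  | r + 1, M => ((range M).filter fun i => 0 < i ∧ i ≡ r + 1 [MOD 2]).biUnion fun i =>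
      (indexFinset r i).image fun m => Fin.snoc (α := fun _ => ℕ) m i

lemma mem_indexFinset {r M : ℕ} {m : Fin r → ℕ} :
    m ∈ indexFinset r M ↔ m ∈ indexSet r ∧ ∀ j, m j < M := by
  induction r generalizing M with
  | zero =>
    simp only [indexFinset, mem_singleton, IsEmpty.forall_iff, and_true]
    exact ⟨fun _ => ⟨fun a => a.elim0, fun a => a.elim0⟩, fun _ => Subsingleton.elim _ _⟩
  | succ r ih =>
    induction m using Fin.snocCases with
    | snoc m a =>
    simp only [indexFinset, mem_biUnion, mem_filter, mem_range, mem_image, ih, snoc_mem_indexSet,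
      Fin.forall_fin_succ', Fin.snoc_castSucc, Fin.snoc_last]
    constructor
    · rintro ⟨i, ⟨hi, hp⟩, m', ⟨hm, hlt⟩, he⟩
      obtain ⟨rfl, rfl⟩ := Fin.snoc_injective2 he
      exact ⟨⟨hm, hlt, hp⟩, fun j => (hlt j).trans hi, hi⟩
    · rintro ⟨⟨hm, hlt, hp⟩, -, hi⟩
      exact ⟨a, ⟨hi, hp⟩, m, ⟨hm, hlt⟩, rfl⟩

lemma sum_indexFinset_succ {r : ℕ} (M : ℕ) (f : (Fin (r + 1) → ℕ) → ℝ) :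
    ∑ m ∈ indexFinset (r + 1) M, f m =
      ∑ i ∈ (range M).filter fun i => 0 < i ∧ i ≡ r + 1 [MOD 2],
        ∑ m ∈ indexFinset r i, f (Fin.snoc (α := fun _ => ℕ) m i) := by
  rw [indexFinset, Finset.sum_biUnion]
  · refine Finset.sum_congr rfl fun i _ => Finset.sum_image fun a _ b _ h => ?_
    exact (Fin.snoc_injective2 h).1
  · intro i _ j _ hij
    rw [Function.onFun, Finset.disjoint_left]
    simp only [mem_image]
    rintro _ ⟨a, _, rfl⟩ ⟨b, _, h⟩
    exact hij (Fin.snoc_injective2 h).2.symm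

/-- Iterates `coef_succ`. Positivity of `M` matters at depth zero, where the empty tuple contributes
1. -/
lemma sum_indexFinset_eq_sum_coef (r M : ℕ) (hM : 0 < M) :
    ∑ m ∈ indexFinset r M, ∏ j, (2 / (m j : ℝ)) = ∑ i ∈ range M, coef r i := by
  induction r generalizing M with
  | zero => simp [indexFinset, coef_zero_left, hM]
  | succ r ih =>
    rw [sum_indexFinset_succ, Finset.sum_filter]
    refine Finset.sum_congr rfl fun i _ => ?_
    split_ifs with hi
    · rw [coef_succ r i hi.2, ← ih i hi.1, Finset.mul_sum]
      refine Finset.sum_congr rfl fun m _ => ?_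
      rw [Fin.prod_univ_castSucc, mul_comm]
      simp only [Fin.snoc_castSucc, Fin.snoc_last]
    · by_cases h0 : 0 < i
      · rw [coef_eq_zero_of_not_modEq _ _ fun h => hi ⟨h0, h⟩]
      · rw [Nat.eq_zero_of_not_pos h0, coef_succ_zero]

lemma summand_onesThen_snoc {r : ℕ} (b : ℕ) (m : Fin r → ℕ) (i : ℕ) :
    1 / ∏ j : Fin (r + 1), ((Fin.snoc (α := fun _ => ℕ) m i : Fin (r + 1) → ℕ) j : ℝ) ^
      onesThen r b j = (∏ j, 1 / (m j : ℝ)) * (1 / (i : ℝ) ^ b) := by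
  simp [onesThen, Fin.prod_univ_castSucc, mul_comm]

/-- One factor `1 / i` of the last entry is absorbed into `coef`, which lowers the exponent from `b
+ 1` to `b`. -/
lemma sum_fiber (r b i : ℕ) (hi : 0 < i) (hir : i ≡ r + 1 [MOD 2]) :
    (2 : ℝ) ^ (r + 1) * ∑ m ∈ indexFinset r i, (∏ j, 1 / (m j : ℝ)) * (1 / (i : ℝ) ^ (b + 1)) =
      coef (r + 1) i / (i : ℝ) ^ b := by
  rw [coef_succ r i hir, ← sum_indexFinset_eq_sum_coef r i hi, ← Finset.sum_mul]
  have h : ∀ m : Fin r → ℕ, ∏ j, (2 / (m j : ℝ)) = 2 ^ r * ∏ j, 1 / (m j : ℝ) := by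
    intro m
    rw [← Fin.prod_const, ← Finset.prod_mul_distrib]
    exact Finset.prod_congr rfl fun j _ => by ring
  simp only [h, ← Finset.mul_sum]
  have : (i : ℝ) ≠ 0 := by positivity
  field_simp
  ring

/-- `indexSet (r + 1)` fibred over the last entry. -/
def indexSetEquiv (r : ℕ) : indexSet (r + 1) ≃
    Σ i : {i : ℕ // 0 < i ∧ i ≡ r + 1 [MOD 2]}, {m // m ∈ indexFinset r i} where
  toFun m :=
    have h := (snoc_mem_indexSet (Fin.init (α := fun _ => ℕ) m.1) (m.1 (Fin.last r))).1
      (by rw [Fin.snoc_init_self]; exact m.2)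
    ⟨⟨m.1 (Fin.last r), h.2.2⟩, ⟨Fin.init (α := fun _ => ℕ) m.1, mem_indexFinset.2 ⟨h.1, h.2.1⟩⟩⟩
  invFun x := ⟨Fin.snoc (α := fun _ => ℕ) x.2.1 x.1.1,
    (snoc_mem_indexSet _ _).2 ⟨(mem_indexFinset.1 x.2.2).1, (mem_indexFinset.1 x.2.2).2, x.1.2⟩⟩
  left_inv m := Subtype.ext (Fin.snoc_init_self _)
  right_inv := by
    rintro ⟨⟨i, hi⟩, ⟨m, hm⟩⟩
    simp only [Fin.snoc_last, Fin.init_snoc, Sigma.mk.injEq, true_and]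
    exact (Subtype.heq_iff_coe_eq (by simp)).2 rfl

/-- Summing over the last entry, `T({1}^r, b + 1)` is `∑ coef (r + 1) i / i ^ b`. -/
lemma hasSum_summand_onesThen (r b : ℕ) {s : ℝ}
    (h : HasSum (fun i : ℕ => coef (r + 1) i / (i : ℝ) ^ b) s) :
    HasSum (summand (onesThen r (b + 1))) (s / 2 ^ (r + 1)) := by
  rw [← (indexSetEquiv r).symm.hasSum_iff]
  have hfib : ∀ i : {i : ℕ // 0 < i ∧ i ≡ r + 1 [MOD 2]},
      HasSum (fun m : {m // m ∈ indexFinset r i} =>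
        (summand (onesThen r (b + 1)) ∘ (indexSetEquiv r).symm) ⟨i, m⟩)
        (coef (r + 1) i / (i : ℝ) ^ b / 2 ^ (r + 1)) := by
    intro i
    rw [← sum_fiber r b i i.2.1 i.2.2, mul_div_cancel_left₀ _ (by positivity),
      ← Finset.sum_coe_sort]
    convert hasSum_fintype _ using 2
    exact (summand_onesThen_snoc (b + 1) _ _).symm
  have hs : HasSum (fun i : {i : ℕ // 0 < i ∧ i ≡ r + 1 [MOD 2]} =>
      coef (r + 1) i / ((i : ℕ) : ℝ) ^ b / 2 ^ (r + 1)) (s / 2 ^ (r + 1)) := by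
    refine HasSum.div_const ?_ _
    refine (Subtype.val_injective.hasSum_iff
      (f := fun i : ℕ => coef (r + 1) i / (i : ℝ) ^ b) ?_).2 h
    intro i hi
    simp only [Subtype.range_coe_subtype, Set.mem_ofPred_eq] at hi
    by_cases h0 : 0 < i
    · rw [coef_eq_zero_of_not_modEq _ _ fun h => hi ⟨h0, h⟩, zero_div]
    · rw [Nat.eq_zero_of_not_pos h0, coef_succ_zero, zero_div]
  have hnn : ∀ x, 0 ≤ (summand (onesThen r (b + 1)) ∘ (indexSetEquiv r).symm) x := by
    intro x
    rw [Function.comp, summand]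
    positivity
  -- The terms are nonnegative, so summability of the fibre totals gives summability over all
  -- tuples.
  have hsum := (summable_sigma_of_nonneg hnn).2
    ⟨fun i => (hfib i).summable, hs.summable.congr fun i => (hfib i).tsum_eq.symm⟩
  have := hsum.hasSum.sigma hfib
  rw [← this.unique hs]
  exact hsum.hasSum

/-! ### The generating function inside the disc, and Abel limits -/

/-- `log ((1 + z) / (1 - z))`, cut along the real half-lines `z ≤ -1` and `z ≥ 1`. -/
def logRatio (z : ℂ) : ℂ := Complex.log (1 + z) - Complex.log (1 - z)

lemma hasSum_logSeries {z : ℂ} (hz : ‖z‖ < 1) :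
    HasSum (fun m => ((PowerSeries.coeff m logSeries : ℝ) : ℂ) * z ^ m) (logRatio z) := by
  have h := (Complex.hasSum_taylorSeries_log hz).add (Complex.hasSum_taylorSeries_neg_log hz)
  rw [← sub_eq_add_neg] at h
  refine h.congr_fun ?_
  intro m
  rw [logSeries, PowerSeries.coeff_mk]
  split_ifs with hm
  · rw [(hm.add_one).neg_one_pow]
    push_cast
    ring
  · rw [(Nat.not_odd_iff_even.1 hm).add_one.neg_one_pow]
    push_cast
    ring

lemma hasSum_coeff_logSeries_pow (r : ℕ) {z : ℂ} (hz : ‖z‖ < 1) :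
    HasSum (fun m => ((PowerSeries.coeff m (logSeries ^ r) : ℝ) : ℂ) * z ^ m) (logRatio z ^ r) := by
  induction r with
  | zero =>
    simp only [pow_zero]
    refine (hasSum_ite_eq 0 (1 : ℂ)).congr_fun fun m => ?_
    rw [PowerSeries.coeff_one]
    split_ifs with h <;> simp [h]
  | succ r ih =>
    have h1 := hasSum_logSeries hz
    have key : (fun m => ((PowerSeries.coeff m (logSeries ^ (r + 1)) : ℝ) : ℂ) * z ^ m) =
        fun m => ∑ p ∈ antidiagonal m, ((PowerSeries.coeff p.1 (logSeries ^ r) : ℝ) : ℂ) * z ^ p.1 *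
          (((PowerSeries.coeff p.2 logSeries : ℝ) : ℂ) * z ^ p.2) := by
      ext m
      rw [pow_succ, PowerSeries.coeff_mul, Complex.ofReal_sum, Finset.sum_mul]
      refine Finset.sum_congr rfl fun p hp => ?_
      rw [← HasAntidiagonal.mem_antidiagonal.1 hp, pow_add]
      push_cast
      ring
    rw [key, pow_succ]
    have hs := (summable_norm_sum_mul_antidiagonal_of_summable_norm
      ih.summable.norm h1.summable.norm).of_norm
    rw [← ih.tsum_eq, ← h1.tsum_eq,
      tsum_mul_tsum_eq_tsum_sum_antidiagonal_of_summable_norm ih.summable.norm h1.summable.norm]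
    exact hs.hasSum

/-- The generating function of `coef r`. -/
lemma hasSum_coef (r : ℕ) {z : ℂ} (hz : ‖z‖ < 1) :
    HasSum (fun m => (coef r m : ℂ) * z ^ m) (logRatio z ^ r / (r ! : ℂ)) := by
  refine ((hasSum_coeff_logSeries_pow r hz).div_const (r ! : ℂ)).congr_fun fun m => ?_
  rw [coef]
  push_cast
  ring

lemma summable_coef_mul_pow (r : ℕ) {x : ℝ} (hx0 : 0 ≤ x) (hx : x < 1) :
    Summable fun m => coef r m * x ^ m := by
  have hz : ‖(x : ℂ)‖ < 1 := by simpa [abs_of_nonneg hx0] using hx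
  have := (hasSum_coef r hz).summable
  exact_mod_cast this

/-- Converse of Abel's limit theorem for nonnegative coefficients. -/
lemma hasSum_of_tendsto_powerSeries {c : ℕ → ℝ} (hc : ∀ m, 0 ≤ c m) {G : ℝ → ℝ} {l : ℝ}
    (hG : ∀ x, 0 < x → x < 1 → HasSum (fun m => c m * x ^ m) (G x))
    (hl : Filter.Tendsto G (nhdsWithin 1 (Set.Iio 1)) (nhds l)) : HasSum c l := by
  have hev : ∀ᶠ x : ℝ in nhdsWithin 1 (Set.Iio 1), 0 < x ∧ x < 1 :=
    Ioo_mem_nhdsLT one_pos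
  have hs : Summable c := by
    -- At each `x < 1` a finite partial sum is at most `G x`; let `x → 1`.
    refine summable_of_sum_le hc (c := l) fun u => ?_
    have h1 : Filter.Tendsto (fun x : ℝ => ∑ m ∈ u, c m * x ^ m) (nhdsWithin 1 (Set.Iio 1))
        (nhds (∑ m ∈ u, c m)) := by
      have : Continuous fun x : ℝ => ∑ m ∈ u, c m * x ^ m := by fun_prop
      simpa using (this.tendsto 1).mono_left nhdsWithin_le_nhds
    refine le_of_tendsto_of_tendsto h1 hl ?_
    filter_upwards [hev] with x hx
    exact sum_le_hasSum u (fun m _ => mul_nonneg (hc m) (pow_nonneg hx.1.le m)) (hG x hx.1 hx.2)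
  have h2 := Real.tendsto_tsum_powerSeries_nhdsWithin_lt hs.hasSum.tendsto_sum_nat
  have h3 : Filter.Tendsto G (nhdsWithin 1 (Set.Iio 1)) (nhds (∑' m, c m)) := by
    refine h2.congr' ?_
    filter_upwards [hev] with x hx
    exact (hG x hx.1 hx.2).tsum_eq
  rw [tendsto_nhds_unique hl h3]
  exact hs.hasSum

/-! ### Boundary values of the logarithm and integrable bounds -/

open scoped Interval

/-- Half-angle factorisation: `1 + e^{iθ} = 2 cos (θ/2) e^{iθ/2}` and `1 - e^{iθ} = 2 sin (θ/2)
e^{i(θ/2 - π/2)}`, with both angles in the principal range. -/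
lemma logRatio_exp {θ : ℝ} (h0 : 0 < θ) (h1 : θ < Real.pi) :
    logRatio (Complex.exp (θ * Complex.I)) =
      -(Real.log (Real.tan (θ / 2)) : ℂ) + (Real.pi / 2 : ℝ) * Complex.I := by
  have hc : 0 < Real.cos (θ / 2) := Real.cos_pos_of_mem_Ioo ⟨by linarith, by linarith⟩
  have hs : 0 < Real.sin (θ / 2) := Real.sin_pos_of_pos_of_lt_pi (by linarith) (by linarith)
  have hpi := Real.pi_pos
  have hexp : Complex.exp (θ * Complex.I) = Complex.exp ((θ / 2 : ℝ) * Complex.I) ^ 2 := by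
    rw [← Complex.exp_nat_mul]
    congr 1
    push_cast
    ring
  have hsq : (Real.cos (θ / 2) : ℂ) ^ 2 + (Real.sin (θ / 2) : ℂ) ^ 2 = 1 := by
    exact_mod_cast Real.cos_sq_add_sin_sq (θ / 2)
  have hI := Complex.I_sq
  have hp : 1 + Complex.exp (θ * Complex.I) =
      ((2 * Real.cos (θ / 2) : ℝ) : ℂ) * Complex.exp ((θ / 2 : ℝ) * Complex.I) := by
    rw [hexp, Complex.exp_mul_I, ← Complex.ofReal_cos, ← Complex.ofReal_sin]
    simp only [Complex.ofReal_mul, Complex.ofReal_ofNat]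
    linear_combination -hsq + (Real.sin (θ / 2) : ℂ) ^ 2 * hI
  have hm : 1 - Complex.exp (θ * Complex.I) =
      ((2 * Real.sin (θ / 2) : ℝ) : ℂ) *
        Complex.exp ((θ / 2 - Real.pi / 2 : ℝ) * Complex.I) := by
    rw [hexp, Complex.exp_mul_I, Complex.exp_mul_I, ← Complex.ofReal_cos, ← Complex.ofReal_sin,
      ← Complex.ofReal_cos, ← Complex.ofReal_sin, Real.cos_sub_pi_div_two,
      Real.sin_sub_pi_div_two]
    simp only [Complex.ofReal_mul, Complex.ofReal_ofNat, Complex.ofReal_neg]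
    linear_combination -hsq - (Real.sin (θ / 2) : ℂ) ^ 2 * hI
  have hre : ∀ x : ℝ, ((x : ℂ) * Complex.I).im = x := by simp
  rw [logRatio, hp, hm, Complex.log_ofReal_mul (by positivity) (Complex.exp_ne_zero _),
    Complex.log_ofReal_mul (by positivity) (Complex.exp_ne_zero _),
    Complex.log_exp (by rw [hre]; linarith) (by rw [hre]; linarith),
    Complex.log_exp (by rw [hre]; linarith) (by rw [hre]; linarith),
    Real.tan_eq_sin_div_cos, Real.log_div hs.ne' hc.ne',
    Real.log_mul two_ne_zero hc.ne', Real.log_mul two_ne_zero hs.ne']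
  push_cast
  ring

lemma norm_log_le_of_sin_le_norm {w : ℂ} {θ : ℝ} (h0 : 0 < θ) (h1 : θ ≤ Real.pi / 2)
    (hw : Real.sin θ ≤ ‖w‖) (hw2 : ‖w‖ ≤ 2) :
    ‖Complex.log w‖ ≤ Real.log Real.pi + Real.pi - Real.log θ := by
  have hpi := Real.pi_pos
  have hsin : 2 / Real.pi * θ ≤ ‖w‖ := (Real.mul_le_sin h0.le h1).trans hw
  have hpos : 0 < 2 / Real.pi * θ := by positivity
  have hlow := Real.log_le_log hpos hsin
  have hup := Real.log_le_log (hpos.trans_le hsin) hw2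
  have hθ := Real.log_le_log h0 h1
  rw [Real.log_mul (by positivity) h0.ne', Real.log_div two_ne_zero hpi.ne'] at hlow
  rw [Real.log_div hpi.ne' two_ne_zero] at hθ
  have hl2 : 0 ≤ Real.log 2 := Real.log_nonneg one_le_two
  have habs : |Real.log ‖w‖| ≤ Real.log Real.pi - Real.log θ :=
    abs_le.2 ⟨by linarith, by linarith⟩
  refine (Complex.norm_le_abs_re_add_abs_im _).trans ?_
  rw [Complex.log_re, Complex.log_im]
  linarith [Complex.abs_arg_le_pi w]

lemma norm_logRatio_le {x θ : ℝ} (hx0 : 0 < x) (hx1 : x ≤ 1) (h0 : 0 < θ)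
    (h1 : θ ≤ Real.pi / 2) :
    ‖logRatio (x * Complex.exp (θ * Complex.I))‖ ≤
      2 * (Real.log Real.pi + Real.pi - Real.log θ) := by
  have hnorm : ‖(x : ℂ) * Complex.exp (θ * Complex.I)‖ ≤ 1 := by
    simpa [Complex.norm_exp_ofReal_mul_I, abs_of_pos hx0] using hx1
  have hre : ((x : ℂ) * Complex.exp (θ * Complex.I)).re = x * Real.cos θ := by
    simp [Complex.exp_mul_I, ← Complex.ofReal_cos, ← Complex.ofReal_sin]
  have him : ((x : ℂ) * Complex.exp (θ * Complex.I)).im = x * Real.sin θ := by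
    simp [Complex.exp_mul_I, ← Complex.ofReal_cos, ← Complex.ofReal_sin]
  have hsq := Real.sin_sq_add_cos_sq θ
  have hbound : ∀ w : ℂ, w = 1 + x * Complex.exp (θ * Complex.I) ∨
      w = 1 - x * Complex.exp (θ * Complex.I) →
      ‖Complex.log w‖ ≤ Real.log Real.pi + Real.pi - Real.log θ := by
    intro w hw
    refine norm_log_le_of_sin_le_norm h0 h1 ?_ ?_
    -- `|1 ± x e^{iθ}|² - sin² θ = (x ± cos θ)²`, so the bound is uniform in `x`.
    · refine abs_le_of_sq_le_sq' ?_ (norm_nonneg _) |>.2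
      rw [Complex.sq_norm, Complex.normSq_apply]
      rcases hw with rfl | rfl
      · simp only [Complex.add_re, Complex.one_re, Complex.add_im, Complex.one_im, hre, him]
        nlinarith [sq_nonneg (x + Real.cos θ)]
      · simp only [Complex.sub_re, Complex.one_re, Complex.sub_im, Complex.one_im, hre, him]
        nlinarith [sq_nonneg (x - Real.cos θ)]
    · rcases hw with rfl | rfl
      · refine (norm_add_le _ _).trans ?_
        rw [norm_one]
        linarith
      · refine (norm_sub_le _ _).trans ?_
        rw [norm_one]
        linarith
  rw [logRatio]
  refine (norm_sub_le _ _).trans ?_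
  linarith [hbound _ (Or.inl rfl), hbound _ (Or.inr rfl)]

lemma exists_norm_logRatio_pow_le (N : ℕ) : ∃ D : ℝ, ∀ x θ : ℝ, 0 < x → x ≤ 1 → 0 < θ →
    θ ≤ Real.pi / 2 →
    ‖logRatio (x * Complex.exp (θ * Complex.I)) ^ N‖ ≤ D * θ ^ (-(1 / 2) : ℝ) := by
  set K := Real.log Real.pi + Real.pi
  refine ⟨4 ^ N * (N ! : ℝ) * Real.exp (K / 2), fun x θ hx0 hx1 h0 h1 => ?_⟩
  have h := norm_logRatio_le hx0 hx1 h0 h1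
  have hnn : 0 ≤ (K - Real.log θ) / 2 := by
    linarith [norm_nonneg (logRatio (x * Complex.exp (θ * Complex.I)))]
  have hfac : (0 : ℝ) < N ! := by positivity
  -- With `y = (K - log θ) / 2`, `y ^ N ≤ N! e^y`; the half makes `e^y` a multiple of `θ^{-1/2}`,
  -- integrable at 0.
  have hexp := Real.pow_div_factorial_le_exp _ hnn N
  rw [div_le_iff₀ hfac] at hexp
  rw [norm_pow]
  calc ‖logRatio (x * Complex.exp (θ * Complex.I))‖ ^ N
      ≤ (4 * ((K - Real.log θ) / 2)) ^ N :=
        pow_le_pow_left₀ (norm_nonneg _) (by linarith) N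
    _ = 4 ^ N * ((K - Real.log θ) / 2) ^ N := mul_pow _ _ _
    _ ≤ 4 ^ N * (Real.exp ((K - Real.log θ) / 2) * N !) := by gcongr
    _ = 4 ^ N * (N ! : ℝ) * Real.exp (K / 2) * θ ^ (-(1 / 2) : ℝ) := by
        rw [Real.rpow_def_of_pos h0, mul_assoc (4 ^ N * (N ! : ℝ)), ← Real.exp_add]
        ring_nf

lemma measurable_logRatio : Measurable logRatio :=
  (Complex.measurable_log.comp (measurable_const.add measurable_id)).sub
    (Complex.measurable_log.comp (measurable_const.sub measurable_id))

lemma intervalIntegrable_const_mul_rpow (D : ℝ) :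
    IntervalIntegrable (fun θ : ℝ => D * θ ^ (-(1 / 2) : ℝ)) MeasureTheory.volume 0
      (Real.pi / 2) :=
  (intervalIntegral.intervalIntegrable_rpow' (by norm_num)).const_mul D

lemma uIoc_zero_pi_div_two : Ι (0 : ℝ) (Real.pi / 2) = Set.Ioc 0 (Real.pi / 2) :=
  Set.uIoc_of_le (by positivity)

lemma intervalIntegrable_log_tan_pow (q : ℕ) :
    IntervalIntegrable (fun θ : ℝ => Real.log (Real.tan (θ / 2)) ^ q) MeasureTheory.volume 0
      (Real.pi / 2) := by
  obtain ⟨D, hD⟩ := exists_norm_logRatio_pow_le q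
  refine (intervalIntegrable_const_mul_rpow D).mono_fun ?_ ?_
  · simp_rw [Real.tan_eq_sin_div_cos]
    refine Measurable.aestronglyMeasurable ?_
    fun_prop
  · rw [uIoc_zero_pi_div_two]
    refine (MeasureTheory.ae_restrict_iff' measurableSet_Ioc).2 (Filter.Eventually.of_forall ?_)
    intro θ hθ
    have hpi := Real.pi_pos
    have h := hD 1 θ one_pos le_rfl hθ.1 hθ.2
    rw [Complex.ofReal_one, one_mul, logRatio_exp hθ.1 (by linarith [hθ.2]), norm_pow] at h
    refine le_trans ?_ (h.trans (le_abs_self _))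
    beta_reduce
    rw [norm_pow]
    refine pow_le_pow_left₀ (norm_nonneg _) ?_ q
    refine le_trans (le_of_eq ?_) (Complex.abs_re_le_norm _)
    simp

/-! ### Integration along the quarter circle -/

lemma hasSum_coef_mul_pow_mul_integral (N : ℕ) {f : ℝ → ℝ} (hf : Continuous f) (u : ℂ →L[ℝ] ℝ)
    {x : ℝ} (hx0 : 0 < x) (hx1 : x < 1) :
    HasSum (fun m => coef N m * (∫ θ in (0 : ℝ)..(Real.pi / 2),
        f θ * u (Complex.exp (θ * Complex.I) ^ m)) * x ^ m)
      (∫ θ in (0 : ℝ)..(Real.pi / 2),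
        f θ * u (logRatio (x * Complex.exp (θ * Complex.I)) ^ N / (N ! : ℂ))) := by
  obtain ⟨B, hB⟩ := isCompact_Icc.exists_bound_of_continuousOn
    (s := Set.Icc (0 : ℝ) (Real.pi / 2)) hf.continuousOn
  have hsum := summable_coef_mul_pow N hx0.le hx1
  have key : HasSum (fun m => ∫ θ in (0 : ℝ)..(Real.pi / 2),
        f θ * u (coef N m * (x * Complex.exp (θ * Complex.I)) ^ m))
      (∫ θ in (0 : ℝ)..(Real.pi / 2),
        f θ * u (logRatio (x * Complex.exp (θ * Complex.I)) ^ N / (N ! : ℂ))) := by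
    refine intervalIntegral.hasSum_integral_of_dominated_convergence
      (fun m _ => B * (‖u‖ * (coef N m * x ^ m))) ?_ ?_ ?_ ?_ ?_
    · intro m
      refine Continuous.aestronglyMeasurable ?_
      fun_prop
    · intro m
      refine Filter.Eventually.of_forall fun θ hθ => ?_
      rw [uIoc_zero_pi_div_two] at hθ
      have hBθ := hB θ ⟨hθ.1.le, hθ.2⟩
      rw [norm_mul]
      refine mul_le_mul hBθ ?_ (norm_nonneg _) ((norm_nonneg _).trans hBθ)
      refine (u.le_opNorm _).trans (le_of_eq ?_)
      congr 1
      simp [Complex.norm_exp_ofReal_mul_I, abs_of_pos hx0, abs_of_nonneg (coef_nonneg N m)]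
    · exact Filter.Eventually.of_forall fun θ _ => (hsum.mul_left _).mul_left _
    · exact intervalIntegrable_const
    · refine Filter.Eventually.of_forall fun θ _ => ?_
      have hz : ‖(x : ℂ) * Complex.exp (θ * Complex.I)‖ < 1 := by
        simpa [Complex.norm_exp_ofReal_mul_I, abs_of_pos hx0] using hx1
      exact (u.hasSum (hasSum_coef N hz)).mul_left _
  refine key.congr_fun fun m => ?_
  rw [mul_right_comm, ← intervalIntegral.integral_const_mul]
  refine intervalIntegral.integral_congr fun θ _ => ?_
  have : (coef N m : ℂ) * (x * Complex.exp (θ * Complex.I)) ^ m =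
      (coef N m * x ^ m : ℝ) • Complex.exp (θ * Complex.I) ^ m := by
    rw [Complex.real_smul, mul_pow]
    push_cast
    ring
  simp only [this, map_smul, smul_eq_mul]
  ring

lemma continuousAt_logRatio_exp {θ : ℝ} (h0 : 0 < θ) (h1 : θ < Real.pi) :
    ContinuousAt logRatio (Complex.exp (θ * Complex.I)) := by
  have hre : (Complex.exp (θ * Complex.I)).re = Real.cos θ := Complex.exp_ofReal_mul_I_re θ
  have hc1 : Real.cos θ < 1 := by
    simpa using Real.cos_lt_cos_of_nonneg_of_le_pi le_rfl h1.le h0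
  have hc2 : -1 < Real.cos θ := by
    simpa using Real.cos_lt_cos_of_nonneg_of_le_pi h0.le le_rfl h1
  refine ContinuousAt.sub ?_ ?_
  · refine ContinuousAt.clog (by fun_prop) (Complex.mem_slitPlane_iff.2 (Or.inl ?_))
    rw [Complex.add_re, hre, Complex.one_re]
    linarith
  · refine ContinuousAt.clog (by fun_prop) (Complex.mem_slitPlane_iff.2 (Or.inl ?_))
    rw [Complex.sub_re, hre, Complex.one_re]
    linarith

/-- Dominated convergence with majorant a multiple of `θ^{-1/2}`; for `0 < θ ≤ π / 2` the limit
point `e^{iθ}` is off the cuts. -/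
lemma tendsto_integral_logRatio (N : ℕ) {f : ℝ → ℝ} (hf : Continuous f) (u : ℂ →L[ℝ] ℝ) :
    Filter.Tendsto (fun x : ℝ => ∫ θ in (0 : ℝ)..(Real.pi / 2),
        f θ * u (logRatio (x * Complex.exp (θ * Complex.I)) ^ N / (N ! : ℂ)))
      (nhdsWithin 1 (Set.Iio 1))
      (nhds (∫ θ in (0 : ℝ)..(Real.pi / 2),
        f θ * u ((-(Real.log (Real.tan (θ / 2)) : ℂ) + (Real.pi / 2 : ℝ) * Complex.I) ^ N /
          (N ! : ℂ)))) := by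
  obtain ⟨B, hB⟩ := isCompact_Icc.exists_bound_of_continuousOn
    (s := Set.Icc (0 : ℝ) (Real.pi / 2)) hf.continuousOn
  obtain ⟨D, hD⟩ := exists_norm_logRatio_pow_le N
  have hpi := Real.pi_pos
  have hev : ∀ᶠ x : ℝ in nhdsWithin 1 (Set.Iio 1), 0 < x ∧ x < 1 := Ioo_mem_nhdsLT one_pos
  refine intervalIntegral.tendsto_integral_filter_of_dominated_convergence
    (fun θ => B * (‖u‖ * (D * θ ^ (-(1 / 2) : ℝ)))) ?_ ?_ ?_ ?_
  · refine Filter.Eventually.of_forall fun x => Measurable.aestronglyMeasurable ?_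
    refine hf.measurable.mul (u.measurable.comp (Measurable.div_const ?_ _))
    refine (measurable_logRatio.comp ?_).pow_const N
    fun_prop
  · filter_upwards [hev] with x hx
    refine Filter.Eventually.of_forall fun θ hθ => ?_
    rw [uIoc_zero_pi_div_two] at hθ
    have hBθ := hB θ ⟨hθ.1.le, hθ.2⟩
    rw [norm_mul]
    refine mul_le_mul hBθ ?_ (norm_nonneg _) ((norm_nonneg _).trans hBθ)
    refine (u.le_opNorm _).trans (mul_le_mul_of_nonneg_left ?_ (norm_nonneg _))
    refine le_trans ?_ (hD x θ hx.1 hx.2.le hθ.1 hθ.2)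
    rw [norm_div]
    refine div_le_self (norm_nonneg _) ?_
    rw [Complex.norm_natCast]
    exact_mod_cast Nat.factorial_pos N
  · exact ((intervalIntegrable_const_mul_rpow D).const_mul _).const_mul _
  · refine Filter.Eventually.of_forall fun θ hθ => ?_
    rw [uIoc_zero_pi_div_two] at hθ
    have hlt : θ < Real.pi := by linarith [hθ.2]
    rw [← logRatio_exp hθ.1 hlt]
    refine Filter.Tendsto.const_mul _ ((u.continuous.tendsto _).comp ?_)
    refine Filter.Tendsto.div_const (Filter.Tendsto.pow ?_ N) _
    refine (continuousAt_logRatio_exp hθ.1 hlt).tendsto.comp ?_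
    have hcont : Continuous fun x : ℝ => (x : ℂ) * Complex.exp (θ * Complex.I) := by fun_prop
    simpa using (hcont.tendsto 1).mono_left nhdsWithin_le_nhds

/-- Integration of the generating function of `coef N` along the quarter circle. -/
lemma hasSum_coef_mul_of_integral_eq (N : ℕ) {f : ℝ → ℝ} (hf : Continuous f) (u : ℂ →L[ℝ] ℝ)
    {t : ℕ → ℝ} (ht : ∀ m, 0 ≤ t m) {C : ℝ} (hC : C ≠ 0)
    (hint : ∀ m, coef N m ≠ 0 →
      ∫ θ in (0 : ℝ)..(Real.pi / 2), f θ * u (Complex.exp (θ * Complex.I) ^ m) = C * t m) :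
    HasSum (fun m => coef N m * t m) (C⁻¹ * ∫ θ in (0 : ℝ)..(Real.pi / 2),
      f θ * u ((-(Real.log (Real.tan (θ / 2)) : ℂ) + (Real.pi / 2 : ℝ) * Complex.I) ^ N /
        (N ! : ℂ))) := by
  refine hasSum_of_tendsto_powerSeries (fun m => mul_nonneg (coef_nonneg N m) (ht m))
    (fun x hx0 hx1 => ?_) ((tendsto_integral_logRatio N hf u).const_mul C⁻¹)
  refine ((hasSum_coef_mul_pow_mul_integral N hf u hx0 hx1).mul_left C⁻¹).congr_fun fun m => ?_
  by_cases h : coef N m = 0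
  · simp [h]
  · rw [hint m h]
    field_simp

/-! ### Fourier integrals of Bernoulli polynomials -/

lemma integral_eq_two_mul_of_symm {g : ℝ → ℝ} (hg : Continuous g) (h : ∀ t, g (1 - t) = g t) :
    ∫ t in (0 : ℝ)..1, g t = 2 * ∫ t in (0 : ℝ)..(1 / 2), g t := by
  rw [← intervalIntegral.integral_add_adjacent_intervals (b := 1 / 2)
    (hg.intervalIntegrable _ _) (hg.intervalIntegrable _ _)]
  have h1 := intervalIntegral.integral_comp_sub_left (a := 0) (b := 1 / 2) g 1
  simp only [h] at h1
  norm_num at h1 ⊢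
  rw [← h1]
  ring

lemma integral_comp_div_pi (g : ℝ → ℝ) :
    ∫ θ in (0 : ℝ)..(Real.pi / 2), g (θ / Real.pi) = Real.pi * ∫ t in (0 : ℝ)..(1 / 2), g t := by
  rw [intervalIntegral.integral_comp_div _ Real.pi_ne_zero, zero_div, smul_eq_mul]
  congr 2
  field_simp

/-- Removes the term free of `log tan` from the real part of the expansion. -/
lemma integral_bernoulliFun_half {p : ℕ} (hp : p ≠ 0) (he : Even p) :
    ∫ θ in (0 : ℝ)..(Real.pi / 2), bernoulliFun p (θ / Real.pi) = 0 := by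
  have h := integral_eq_two_mul_of_symm (continuous_bernoulliFun p)
    fun t => by rw [bernoulliFun_eval_one_sub, he.neg_one_pow, one_mul]
  rw [integral_bernoulliFun_eq_zero hp] at h
  rw [integral_comp_div_pi]
  simp at h ⊢
  exact h

lemma integral_bernoulliFun_mul_exp {p : ℕ} (hp : p ≠ 0) (j : ℕ) (u : ℂ →L[ℝ] ℝ) :
    ∫ t in (0 : ℝ)..1, bernoulliFun p t * u (Complex.exp (2 * Real.pi * j * t * Complex.I)) =
      u (-(p ! : ℂ) / (-(2 * Real.pi * j * Complex.I)) ^ p) := by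
  have h := bernoulliFourierCoeff_eq hp (-(j : ℤ))
  rw [bernoulliFourierCoeff, fourierCoeffOn_eq_integral] at h
  have harg : (2 * Real.pi * Complex.I * ((-(j : ℤ) : ℤ) : ℂ)) =
      -(2 * Real.pi * j * Complex.I) := by
    push_cast
    ring
  rw [harg] at h
  rw [← h, sub_zero, div_one, one_smul, ← u.intervalIntegral_comp_comm]
  · refine intervalIntegral.integral_congr fun t _ => ?_
    simp only [neg_neg, fourier_coe_apply, smul_eq_mul]
    rw [mul_comm (Complex.exp _), ← Complex.real_smul, map_smul, smul_eq_mul]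
    congr 3
    push_cast
    ring
  · refine Continuous.intervalIntegrable ?_ _ _
    simp only [neg_neg, fourier_coe_apply, smul_eq_mul]
    have := continuous_bernoulliFun p
    fun_prop

/-- Under `t ↦ 1 - t` the Bernoulli factor gains `(-1) ^ p` and the exponential is conjugated, so
`u` gains the same sign. The integrand is symmetric, and the half period gives half the Fourier
coefficient. -/
lemma integral_bernoulliFun_mul_exp_half {p : ℕ} (hp : p ≠ 0) (j : ℕ) (u : ℂ →L[ℝ] ℝ)
    (hu : ∀ z : ℂ, u ((starRingEnd ℂ) z) = (-1) ^ p * u z) :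
    ∫ θ in (0 : ℝ)..(Real.pi / 2), bernoulliFun p (θ / Real.pi) *
        u (Complex.exp (θ * Complex.I) ^ (2 * j)) =
      Real.pi / 2 * u (-(p ! : ℂ) / (-(2 * Real.pi * j * Complex.I)) ^ p) := by
  have hB := continuous_bernoulliFun p
  rw [← integral_bernoulliFun_mul_exp hp, integral_eq_two_mul_of_symm]
  · have h := integral_comp_div_pi fun t => bernoulliFun p t *
      u (Complex.exp (2 * Real.pi * j * t * Complex.I))
    rw [div_mul_eq_mul_div, mul_div_assoc, mul_div_cancel_left₀ _ two_ne_zero, ← h]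
    refine intervalIntegral.integral_congr fun θ _ => ?_
    simp only [← Complex.exp_nat_mul]
    congr 3
    have := Complex.ofReal_ne_zero.2 Real.pi_ne_zero
    push_cast
    field_simp
  · fun_prop
  · intro t
    have hexp : Complex.exp (2 * Real.pi * j * (1 - t : ℝ) * Complex.I) =
        (starRingEnd ℂ) (Complex.exp (2 * Real.pi * j * t * Complex.I)) := by
      rw [← Complex.exp_conj]
      simp only [map_mul, Complex.conj_ofReal, Complex.conj_I, map_ofNat, map_natCast]
      rw [Complex.exp_eq_exp_iff_exists_int]
      refine ⟨j, ?_⟩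
      push_cast
      ring
    rw [hexp, hu, bernoulliFun_eval_one_sub, mul_mul_mul_comm, ← mul_pow]
    norm_num

/-! ### Binomial expansion and the two formulas -/

/-- The sums over odd `m` and over even `m` in the expansion of `(x + i y) ^ (2 n)`. -/
lemma add_mul_I_pow_div_factorial (n : ℕ) (x y : ℝ) :
    ((x : ℂ) + y * Complex.I) ^ (2 * n) / ((2 * n) ! : ℂ) =
      ((∑ m ∈ range n, (-1) ^ m * y ^ (2 * m) / ((2 * m) ! * (2 * n - 2 * m) !) *
          x ^ (2 * n - 2 * m) + (-1) ^ n * y ^ (2 * n) / (2 * n) ! : ℝ) : ℂ) +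
      ((∑ m ∈ range n, (-1) ^ m * y ^ (2 * m + 1) / ((2 * m + 1) ! * (2 * n - 2 * m - 1) !) *
          x ^ (2 * n - 2 * m - 1) : ℝ) : ℂ) * Complex.I := by
  have hsplit : ∀ f : ℕ → ℂ, ∑ i ∈ range (2 * n + 1), f i =
      ∑ m ∈ range n, (f (2 * m) + f (2 * m + 1)) + f (2 * n) := by
    intro f
    rw [Finset.sum_range_succ]
    congr 1
    clear x y
    induction n with
    | zero => simp
    | succ n ih => rw [Finset.sum_range_succ, ← ih, mul_add_one, Finset.sum_range_succ,
        Finset.sum_range_succ, add_assoc]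
  have hI : ∀ m, ((y : ℂ) * Complex.I) ^ (2 * m) = (-1) ^ m * y ^ (2 * m) := by
    intro m
    rw [mul_pow, pow_mul Complex.I, Complex.I_sq, mul_comm]
  have hch : ∀ i, i ≤ 2 * n → ((2 * n).choose i : ℂ) =
      (2 * n) ! / ((i ! : ℂ) * (2 * n - i) !) := fun i hi => Nat.cast_choose ℂ hi
  have hf : ∀ i : ℕ, (i ! : ℂ) ≠ 0 := fun i => by exact_mod_cast Nat.factorial_ne_zero i
  rw [add_comm (x : ℂ), add_pow, hsplit, Finset.sum_add_distrib]
  push_cast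
  rw [add_right_comm, add_div, add_div, Finset.sum_div, Finset.sum_div, Finset.sum_mul]
  congr 1
  · congr 1
    · refine Finset.sum_congr rfl fun m hm => ?_
      rw [hI, hch _ (by have := mem_range.1 hm; omega)]
      have := hf (2 * n)
      have := hf (2 * m)
      have := hf (2 * n - 2 * m)
      field_simp
    · rw [hI]
      simp
  · refine Finset.sum_congr rfl fun m hm => ?_
    rw [pow_succ ((y : ℂ) * Complex.I), hI, hch _ (by have := mem_range.1 hm; omega),
      Nat.sub_sub (2 * n) (2 * m) 1]
    have := hf (2 * n)
    have := hf (2 * m + 1)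
    have := hf (2 * n - (2 * m + 1))
    field_simp
    ring

/-- Integral representation of `T({1}^r, p + 1)` for odd `r`, with `u` the real part for even `p`
and the imaginary part for odd `p`. -/
lemma T_onesThen_eq_integral {r n p : ℕ} (hr : r + 1 = 2 * n) (hp : p ≠ 0) (u : ℂ →L[ℝ] ℝ)
    (hu : ∀ z : ℂ, u ((starRingEnd ℂ) z) = (-1) ^ p * u z) {c : ℝ} (hc : c ≠ 0)
    (huc : u (-1 / (-Complex.I) ^ p) = c) :
    Summable (summand (onesThen r (p + 1))) ∧
      T (onesThen r (p + 1)) = Real.pi ^ p / p ! * (c * (Real.pi / 2))⁻¹ *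
        ∫ θ in (0 : ℝ)..(Real.pi / 2), bernoulliFun p (θ / Real.pi) *
          u ((-(Real.log (Real.tan (θ / 2)) : ℂ) + (Real.pi / 2 : ℝ) * Complex.I) ^ (2 * n) /
            ((2 * n) ! : ℂ)) := by
  have hpi := Real.pi_pos
  have hB := continuous_bernoulliFun p
  have hfac : (p ! : ℝ) ≠ 0 := by positivity
  -- For `m = 2j`, the Fourier factor `p! / (2πj) ^ p` is `(p! / π ^ p) / m ^ p`.
  have hC : Real.pi / 2 * (p ! / Real.pi ^ p * c) ≠ 0 := by positivity
  have h := hasSum_coef_mul_of_integral_eq (2 * n) (f := fun θ => bernoulliFun p (θ / Real.pi))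
    (by fun_prop) u (t := fun m => 1 / (m : ℝ) ^ p) (fun m => by positivity) hC ?_
  · rw [← hr] at h
    have h2 := hasSum_summand_onesThen r p (h.congr_fun fun m => by rw [mul_one_div])
    refine ⟨h2.summable, ?_⟩
    rw [T, h2.tsum_eq, mul_div_cancel₀ _ (by positivity), hr]
    congr 1
    field_simp
  · intro m hm
    have hmod : m ≡ 2 * n [MOD 2] := by
      by_contra hcon
      exact hm (coef_eq_zero_of_not_modEq _ _ hcon)
    obtain ⟨j, rfl⟩ : ∃ j, m = 2 * j := ⟨m / 2, by simp only [Nat.ModEq] at hmod; omega⟩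
    have hj : (j : ℝ) ≠ 0 := by
      rintro hj
      rw [Nat.cast_eq_zero] at hj
      rw [hj, ← hr, mul_zero, coef_succ_zero] at hm
      exact hm rfl
    have hval : (-(p ! : ℂ) / (-(2 * Real.pi * j * Complex.I)) ^ p) =
        (p ! / (2 * Real.pi * j) ^ p : ℝ) • (-1 / (-Complex.I) ^ p) := by
      rw [Complex.real_smul, ← mul_neg, mul_pow]
      push_cast
      rw [_root_.div_mul_div_comm]
      ring
    rw [integral_bernoulliFun_mul_exp_half hp j u hu, hval, map_smul, huc, smul_eq_mul]
    push_cast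
    field_simp
    ring

lemma intervalIntegrable_bernoulliFun_mul_log_tan_pow (p q : ℕ) :
    IntervalIntegrable (fun θ : ℝ => bernoulliFun p (θ / Real.pi) *
      Real.log (Real.tan (θ / 2)) ^ q) MeasureTheory.volume 0 (Real.pi / 2) := by
  have := continuous_bernoulliFun p
  exact (intervalIntegrable_log_tan_pow q).continuousOn_mul (by fun_prop)

lemma integral_bernoulliFun_mul_sum (p n : ℕ) (a : ℕ → ℝ) (q : ℕ → ℕ) :
    ∫ θ in (0 : ℝ)..(Real.pi / 2), bernoulliFun p (θ / Real.pi) *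
        ∑ m ∈ range n, a m * Real.log (Real.tan (θ / 2)) ^ q m =
      ∑ m ∈ range n, a m * ∫ θ in (0 : ℝ)..(Real.pi / 2), bernoulliFun p (θ / Real.pi) *
        Real.log (Real.tan (θ / 2)) ^ q m := by
  simp only [← intervalIntegral.integral_const_mul]
  rw [← intervalIntegral.integral_finsetSum]
  · refine intervalIntegral.integral_congr fun θ _ => ?_
    simp only [Finset.mul_sum]
    exact Finset.sum_congr rfl fun m _ => by ring
  · intro m _
    exact (intervalIntegrable_bernoulliFun_mul_log_tan_pow p (q m)).const_mul _

/-- Here `-1 / (-i) ^ (2l + 1) = -(-1) ^ l i`, whose minus sign cancels the one from the odd power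
of `-log tan`. -/
lemma summable_and_T_onesThen_even {r n : ℕ} (hr : r + 1 = 2 * n) (l : ℕ) :
    Summable (summand (onesThen r (2 * l + 1 + 1))) ∧
      T (onesThen r (2 * l + 1 + 1)) = Real.pi ^ (2 * l + 1) / (2 * l + 1)! *
        ∑ m ∈ range n, (-1 : ℝ) ^ (l + m) * (Real.pi / 2) ^ (2 * m) /
            ((2 * m + 1)! * (2 * n - 2 * m - 1)!) *
          ∫ θ in (0 : ℝ)..(Real.pi / 2), bernoulliFun (2 * l + 1) (θ / Real.pi) *
            Real.log (Real.tan (θ / 2)) ^ (2 * n - 2 * m - 1) := by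
  have hpi := Real.pi_ne_zero
  have hl : ((-1 : ℝ) ^ l) ≠ 0 := pow_ne_zero _ (by norm_num)
  have hll : ((-1 : ℝ) ^ l) * (-1) ^ l = 1 := by rw [← mul_pow]; norm_num
  obtain ⟨h1, h2⟩ := T_onesThen_eq_integral (p := 2 * l + 1) hr (by omega) Complex.imCLM
    (c := -(-1) ^ l) (fun z => by simp [pow_succ, pow_mul]) (neg_ne_zero.2 hl) (by
      rw [pow_succ, pow_mul, neg_sq, Complex.I_sq,
        show (-1 : ℂ) / ((-1) ^ l * -Complex.I) = ((-(-1) ^ l : ℝ) : ℂ) * Complex.I from ?_]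
      · rw [Complex.imCLM_apply, Complex.im_ofReal_mul, Complex.I_im, mul_one]
      · have hlc : ((-1 : ℂ) ^ l) * (-1) ^ l = 1 := by rw [← mul_pow]; norm_num
        have hlc0 : ((-1 : ℂ) ^ l) ≠ 0 := left_ne_zero_of_mul_eq_one hlc
        have hI := Complex.I_sq
        have hI0 := Complex.I_ne_zero
        rw [div_eq_iff (mul_ne_zero hlc0 (neg_ne_zero.2 hI0))]
        push_cast
        linear_combination -hlc * Complex.I ^ 2 - hI)
  refine ⟨h1, h2.trans ?_⟩
  have hcongr : ∀ θ : ℝ, Complex.imCLM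
      ((-(Real.log (Real.tan (θ / 2)) : ℂ) + (Real.pi / 2 : ℝ) * Complex.I) ^ (2 * n) /
        ((2 * n) ! : ℂ)) =
      ∑ m ∈ range n, (-((-1) ^ m * (Real.pi / 2) ^ (2 * m + 1) /
        ((2 * m + 1)! * (2 * n - 2 * m - 1)!))) *
          Real.log (Real.tan (θ / 2)) ^ (2 * n - 2 * m - 1) := by
    intro θ
    rw [← Complex.ofReal_neg, add_mul_I_pow_div_factorial, Complex.imCLM_apply,
      Complex.add_im, Complex.ofReal_im, zero_add, Complex.im_ofReal_mul, Complex.I_im, mul_one]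
    refine Finset.sum_congr rfl fun m hm => ?_
    have hodd : Odd (2 * n - 2 * m - 1) := ⟨n - m - 1, by have := mem_range.1 hm; omega⟩
    rw [hodd.neg_pow]
    ring
  simp only [hcongr]
  rw [integral_bernoulliFun_mul_sum, mul_assoc, Finset.mul_sum]
  congr 1
  refine Finset.sum_congr rfl fun m _ => ?_
  rw [← mul_assoc]
  congr 1
  rw [pow_add, pow_succ (Real.pi / 2), inv_mul_eq_iff_eq_mul₀ (mul_ne_zero (neg_ne_zero.2 hl) (by positivity))]
  linear_combination ((-1) ^ m * (Real.pi / 2) ^ (2 * m) * (Real.pi / 2) /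
    ((2 * m + 1)! * (2 * n - 2 * m - 1)!)) * hll

/-- Dividing by `π / 2` leaves the exponent `2m - 1`, which is `-1` at `m = 0`; hence the integer
power. -/
lemma summable_and_T_onesThen_odd {r n : ℕ} (hr : r + 1 = 2 * n) (l : ℕ) :
    Summable (summand (onesThen r (2 * (l + 1) + 1))) ∧
      T (onesThen r (2 * (l + 1) + 1)) = Real.pi ^ (2 * (l + 1)) / (2 * (l + 1))! *
        ∑ m ∈ range n, (-1 : ℝ) ^ (l + m) * (Real.pi / 2) ^ (2 * (m : ℤ) - 1) /
            ((2 * m)! * (2 * n - 2 * m)!) *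
          ∫ θ in (0 : ℝ)..(Real.pi / 2), bernoulliFun (2 * (l + 1)) (θ / Real.pi) *
            Real.log (Real.tan (θ / 2)) ^ (2 * n - 2 * m) := by
  have hpi := Real.pi_ne_zero
  have hl : ((-1 : ℝ) ^ l) ≠ 0 := pow_ne_zero _ (by norm_num)
  have hll : ((-1 : ℝ) ^ l) * (-1) ^ l = 1 := by rw [← mul_pow]; norm_num
  obtain ⟨h1, h2⟩ := T_onesThen_eq_integral (p := 2 * (l + 1)) hr (by omega) Complex.reCLM
    (c := (-1) ^ l) (fun z => by simp [pow_mul]) hl (by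
      rw [pow_mul, neg_sq, Complex.I_sq,
        show (-1 : ℂ) / (-1) ^ (l + 1) = (((-1) ^ l : ℝ) : ℂ) from ?_]
      · exact Complex.ofReal_re _
      · have hlc : ((-1 : ℂ) ^ l) * (-1) ^ l = 1 := by rw [← mul_pow]; norm_num
        have hlc0 : ((-1 : ℂ) ^ (l + 1)) ≠ 0 := pow_ne_zero _ (by norm_num)
        rw [div_eq_iff hlc0, pow_succ]
        push_cast
        linear_combination hlc)
  refine ⟨h1, h2.trans ?_⟩
  set E : ℝ := (-1) ^ n * (Real.pi / 2) ^ (2 * n) / (2 * n)!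
  have hcongr : ∀ θ : ℝ, Complex.reCLM
      ((-(Real.log (Real.tan (θ / 2)) : ℂ) + (Real.pi / 2 : ℝ) * Complex.I) ^ (2 * n) /
        ((2 * n) ! : ℂ)) =
      ∑ m ∈ range n, ((-1) ^ m * (Real.pi / 2) ^ (2 * m) /
        ((2 * m)! * (2 * n - 2 * m)!)) *
          Real.log (Real.tan (θ / 2)) ^ (2 * n - 2 * m) + E := by
    intro θ
    rw [← Complex.ofReal_neg, add_mul_I_pow_div_factorial, Complex.reCLM_apply,
      Complex.add_re, Complex.ofReal_re, Complex.re_ofReal_mul, Complex.I_re, mul_zero, add_zero]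
    refine congrArg (· + E) (Finset.sum_congr rfl fun m hm => ?_)
    have heven : Even (2 * n - 2 * m) := ⟨n - m, by omega⟩
    rw [heven.neg_pow]
  simp_rw [hcongr, mul_add (bernoulliFun _ _)]
  rw [intervalIntegral.integral_add, intervalIntegral.integral_mul_const,
    integral_bernoulliFun_half (by omega) (even_two_mul _), zero_mul, add_zero,
    integral_bernoulliFun_mul_sum, mul_assoc, Finset.mul_sum]
  · congr 1
    refine Finset.sum_congr rfl fun m _ => ?_
    rw [← mul_assoc]
    congr 1
    rw [pow_add, zpow_sub_one₀ (by positivity), inv_mul_eq_iff_eq_mul₀ (mul_ne_zero hl (by positivity)),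
      show (2 : ℤ) * m = ((2 * m : ℕ) : ℤ) by push_cast; rfl, zpow_natCast]
    have hpi2 : Real.pi / 2 * (Real.pi / 2)⁻¹ = 1 := mul_inv_cancel₀ (by positivity)
    have hone : ((-1 : ℝ) ^ l * (-1) ^ l) * (Real.pi / 2 * (Real.pi / 2)⁻¹) = 1 := by
      rw [hll, hpi2, one_mul]
    linear_combination (-(-1) ^ m * (Real.pi / 2) ^ (2 * m) /
      ((2 * m)! * (2 * n - 2 * m)!)) * hone
  · simp only [Finset.mul_sum]
    rw [← Finset.sum_fn]
    refine IntervalIntegrable.sum _ fun m _ => ?_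
    refine ((intervalIntegrable_bernoulliFun_mul_log_tan_pow (2 * (l + 1)) (2 * n - 2 * m)).const_mul
      ((-1) ^ m * (Real.pi / 2) ^ (2 * m) / ((2 * m)! * (2 * n - 2 * m)!))).congr ?_
    exact fun θ _ => mul_left_comm _ _ _
  · refine Continuous.intervalIntegrable ?_ _ _
    have := continuous_bernoulliFun (2 * (l + 1))
    fun_prop

end MultipleTValue

theorem mainTheorem8 (n k : ℕ) (hn : 1 ≤ n) (hk : 1 ≤ k) :
    (Summable (MultipleTValue.summand (MultipleTValue.onesThen (2 * n - 1) (2 * k))) ∧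
      (∀ m ∈ Finset.range n, IntervalIntegrable
        (fun θ : ℝ => bernoulliFun (2 * k - 1) (θ / Real.pi) *
          Real.log (Real.tan (θ / 2)) ^ (2 * n - 2 * m - 1))
        MeasureTheory.volume 0 (Real.pi / 2)) ∧
      MultipleTValue.T (MultipleTValue.onesThen (2 * n - 1) (2 * k)) =
        Real.pi ^ (2 * k - 1) / (Nat.factorial (2 * k - 1) : ℝ) *
          ∑ m ∈ Finset.range n,
            (-1 : ℝ) ^ (k + m - 1) * (Real.pi / 2) ^ (2 * m) /
                ((Nat.factorial (2 * m + 1) : ℝ) * (Nat.factorial (2 * n - 2 * m - 1) : ℝ)) *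
              ∫ θ in (0 : ℝ)..(Real.pi / 2),
                bernoulliFun (2 * k - 1) (θ / Real.pi) *
                  Real.log (Real.tan (θ / 2)) ^ (2 * n - 2 * m - 1)) ∧
    (Summable (MultipleTValue.summand (MultipleTValue.onesThen (2 * n - 1) (2 * k + 1))) ∧
      (∀ m ∈ Finset.range n, IntervalIntegrable
        (fun θ : ℝ => bernoulliFun (2 * k) (θ / Real.pi) *
          Real.log (Real.tan (θ / 2)) ^ (2 * n - 2 * m))
        MeasureTheory.volume 0 (Real.pi / 2)) ∧
      MultipleTValue.T (MultipleTValue.onesThen (2 * n - 1) (2 * k + 1)) =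
        Real.pi ^ (2 * k) / (Nat.factorial (2 * k) : ℝ) *
          ∑ m ∈ Finset.range n,
            (-1 : ℝ) ^ (k + m - 1) * (Real.pi / 2) ^ (2 * (m : ℤ) - 1) /
                ((Nat.factorial (2 * m) : ℝ) * (Nat.factorial (2 * n - 2 * m) : ℝ)) *
              ∫ θ in (0 : ℝ)..(Real.pi / 2),
                bernoulliFun (2 * k) (θ / Real.pi) *
                  Real.log (Real.tan (θ / 2)) ^ (2 * n - 2 * m)) := by
  have hr : 2 * n - 1 + 1 = 2 * n := by omega
  -- Writing `k = l + 1` removes the truncated subtractions in `k + m - 1` and `2k - 1`.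
  obtain ⟨l, rfl⟩ : ∃ l, k = l + 1 := ⟨k - 1, by omega⟩
  have hexp : ∀ m, l + 1 + m - 1 = l + m := fun m => by omega
  have h1 : 2 * (l + 1) - 1 = 2 * l + 1 := by omega
  have h2 : 2 * (l + 1) = 2 * l + 1 + 1 := by ring
  obtain ⟨he, hTe⟩ := MultipleTValue.summable_and_T_onesThen_even hr l
  obtain ⟨ho, hTo⟩ := MultipleTValue.summable_and_T_onesThen_odd hr l
  simp only [hexp]
  refine ⟨?_, ho, fun m _ => ?_, hTo⟩
  · rw [h1, h2]
    exact ⟨he, fun m _ => MultipleTValue.intervalIntegrable_bernoulliFun_mul_log_tan_pow _ _, hTe⟩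
  · exact MultipleTValue.intervalIntegrable_bernoulliFun_mul_log_tan_pow _ _

end
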